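/- Let $\mu$ be a cardinal, $\lambda = \mu^+$, and let $\delta(*)$ be a limit ordinal with $|\delta(*)| < \mu$ and $\mathrm{cf}(\delta(*)) \neq \mathrm{cf}(\mu)$. Then there are a stationary set $S \subseteq \{\delta < \lambda : \mathrm{cf}(\delta) = \mathrm{cf}(\delta(*))\}$ and a sequence $\bar{\mathcal P} = \langle \mathcal P_\alpha : \alpha < \lambda\rangle$ such that: (i) for every $\alpha < \lambda$, $\mathcal P_\alpha$ is a family of closed subsets of $\alpha$ and $|\mathcal P_\alpha| < \lambda$; (ii) if $\alpha \in \lambda \setminus S$ and $C \in \mathcal P_\alpha$, then $\mathrm{otp}(C) < \delta(*)$; (iii) if $\alpha \in S$, then $\mathcal P_\alpha = \{C_\alpha\}$ for some club $C_\alpha$ of $\alpha$ with $\mathrm{otp}(C_\alpha) = \delta(*)$ and $C_\alpha \cap S = \emptyset$; (iv) if $\alpha < \lambda$, $C \in \mathcal P_\alpha$ and $\beta \in \mathrm{nacc}(C)$, then $C \cap \beta \in \mathcal P_\beta$; (v) for every club $E$ of $\lambda$ there is $\delta \in S$ with $C_\delta \subseteq E$. Here $\mathrm{otp}$ denotes order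 type, and $\mathrm{nacc}(C)$ is the set of those $\beta \in C$ that are not limits of elements of $C$ below $\beta$. -/

import Mathlib

universe u

open Set Cardinal
open scoped Ordinal Set.Notation

namespace ClubGuessing

/-- `C` is a closed subset of the ordinal `α` (identified with the set `Iio α` of ordinals below
`α`, with its order topology). -/
def IsClosedIn (C : Set Ordinal.{u}) (α : Ordinal.{u}) : Prop :=
  C ⊆ Iio α ∧ IsClosed (Iio α ↓∩ C)

/-- `C` is a club (closed unbounded subset) of the ordinal `α`. -/
def IsClubIn (C : Set Ordinal.{u}) (α : Ordinal.{u}) : Prop :=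
  C ⊆ Iio α ∧ IsClub (Iio α ↓∩ C)

/-- `S` is a stationary subset of the ordinal `α`. -/
def IsStationaryIn (S : Set Ordinal.{u}) (α : Ordinal.{u}) : Prop :=
  S ⊆ Iio α ∧ IsStationary (Iio α ↓∩ S)

/-- The set of non-accumulation members of `C`: those `β ∈ C` that are not limits of
members of `C` below `β`. -/
def nacc (C : Set Ordinal.{u}) : Set Ordinal.{u} :=
  {β ∈ C | ¬ AccPt β (Filter.principal C)}

/-- The order type of a set of ordinals. -/
noncomputable def otp (C : Set Ordinal.{u}) : Ordinal.{u + 1} :=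
  typeLT C

/-- The family `P = ⟨P α : α < lam⟩` guesses clubs of the cardinal `lam` on `S` by
sets of order type `δ`, with one guess at each point of `S` and with coherence. Only the values
`P α` for `α < lam` matter. -/
structure GuessesClubs (lam : Cardinal.{u}) (δ : Ordinal.{u})
    (P : Ordinal.{u} → Set (Set Ordinal.{u})) (S : Set Ordinal.{u}) : Prop where
  /-- `P α` is a family of fewer than `lam` closed subsets of `α`. -/
  closed : ∀ α < lam.ord, (∀ C ∈ P α, IsClosedIn C α) ∧ #(P α) < Cardinal.lift.{u + 1} lam
  /-- Off `S`, the members of `P α` have order type less than `δ`. -/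
  otp_lt : ∀ α < lam.ord, α ∉ S → ∀ C ∈ P α, otp C < Ordinal.lift.{u + 1} δ
  /-- On `S`, the family `P α` is a singleton, whose member is a club of `α` of order type `δ`
  that is disjoint from `S`. -/
  guess : ∀ α ∈ S, ∃ C, P α = {C} ∧ otp C = Ordinal.lift.{u + 1} δ ∧ IsClubIn C α ∧ Disjoint C S
  /-- Coherence under initial segments at non-accumulation points. -/
  coherent : ∀ α < lam.ord, ∀ C ∈ P α, ∀ β ∈ nacc C, C ∩ Iio β ∈ P β
  /-- Every club of `lam` includes the guess at some point of `S`. -/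
  guesses : ∀ E, IsClubIn E lam.ord → ∃ α ∈ S, ∃ C ∈ P α, C ⊆ E

end ClubGuessing

/-!
Call a normal function `c` on `δ` a ladder for small families `P β`, `β < λ = μ⁺`, if each
`c '' Iic i` belongs to `P (c (i + 1))`.

*Ladders inside every club, `μ` regular.* Enumerations of all `β < λ` by `μ` yield sets `A β i` of
size less than `μ`, increasing in `i < μ` with union `Iic β`, such that `A β i ∩ Iic x = A x i` for
`x ∈ A β i`. Replace each `A β i` by the closure of the set of floors of its elements in a club
`E'`; the coherence persists, so the initial segments of these closures form small families. If some
club defeats them for every choice of `E'`, shrink `E'` by such clubs `μ` many times. The floors of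
the elements of a small `A β i` only decrease, hence stabilize, and `A β i` then contradicts the
choice of the next club.

*Arbitrary `μ`.* The successor `σ = |δ|⁺ ≤ μ` is regular. If `σ < μ`, transfer ladders from `σ⁺` to
`λ` along normal functions with values in the given club. Only the suprema of these functions on
`σ⁺` matter, since any two with the same supremum agree on a club of `σ⁺`.

*One ladder per point.* Since `cof δ ≠ cof μ`, a ladder is the union of those of its initial
segments that occur before some fixed `χ < μ` in an enumeration of all candidates. Which of these
fewer than `μ` sets are included in a shrinking club stabilizes as well, and from then on any ladder
at `γ` serves as well as any other; so one can be fixed for each `γ`. Greedily colour the graph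
joining `γ` to its ladder with `μ` colours: one colour class still guesses every club, and it is
disjoint from its own ladders.
-/

namespace ClubGuessing

section Topology

theorem dirSupClosed_iff_isClosed {α : Type*} [LinearOrder α] [WellFoundedLT α]
    [TopologicalSpace α] [OrderTopology α] {s : Set α} : DirSupClosed s ↔ IsClosed s := by
  refine ⟨fun h ↦ isClosed_of_closure_subset fun x hx ↦ ?_,
    fun h t hts ht _ x hx ↦ h.closure_subset (closure_mono hts (hx.mem_closure ht))⟩
  have hx' : x ∈ closure (Iic x ∩ s) :=
    (isLowerSet_Iic x).isOpen.inter_closure ⟨self_mem_Iic, hx⟩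
  exact h inter_subset_right (closure_nonempty_iff.1 ⟨x, hx'⟩) (.of_linearOrder _)
    (isLUB_of_mem_closure (fun y hy ↦ hy.1) hx')

variable {C E : Set Ordinal.{u}} {o x : Ordinal.{u}}

theorem isClosed_preimage_Iio_iff (hC : C ⊆ Iio o) :
    IsClosed (Iio o ↓∩ C) ↔ closure C ∩ Iio o ⊆ C := by
  rw [isClosed_preimage_val, inter_eq_self_of_subset_right hC, inter_comm]

theorem isClubIn_iff :
    IsClubIn E o ↔ E ⊆ Iio o ∧ closure E ∩ Iio o ⊆ E ∧ ∀ x < o, ∃ y ∈ E, x ≤ y := by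
  refine and_congr_right fun hE ↦ ?_
  rw [isClub_iff, dirSupClosed_iff_isClosed, isClosed_preimage_Iio_iff hE]
  refine and_congr_right fun _ ↦ ⟨fun h x hx ↦ ?_, fun h x ↦ ?_⟩
  · obtain ⟨y, hy, hxy⟩ := h ⟨x, hx⟩
    exact ⟨y, hy, hxy⟩
  · obtain ⟨y, hy, hxy⟩ := h x x.2
    exact ⟨⟨y, hE hy⟩, hy, hxy⟩

theorem IsClubIn.closure_subset (hE : IsClubIn E o) : closure E ∩ Iio o ⊆ E :=
  (isClubIn_iff.1 hE).2.1

theorem IsClubIn.exists_gt (hE : IsClubIn E o) (ho : Order.IsSuccLimit o) (hx : x < o) :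
    ∃ y ∈ E, x < y := by
  obtain ⟨y, hy, hxy⟩ := (isClubIn_iff.1 hE).2.2 _ (ho.succ_lt hx)
  exact ⟨y, hy, (Order.lt_succ x).trans_le hxy⟩

theorem isClubIn_Iio_inter_iInter {ι : Type (u + 1)} {f : ι → Set Ordinal.{u}} (ho : ℵ₀ < o.cof)
    (hι : #ι < Cardinal.lift.{u + 1} o.cof) (hf : ∀ i, IsClubIn (f i) o) :
    IsClubIn (Iio o ∩ ⋂ i, f i) o := by
  have hcof : Order.cof (Iio o) = Cardinal.lift.{u + 1} o.cof := by
    rw [Ordinal.cof_Iio, ← Ordinal.lift_cof]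
  refine ⟨inter_subset_left, ?_⟩
  rw [preimage_inter, Subtype.coe_preimage_self, univ_inter, preimage_iInter]
  refine IsClub.iInter ?_ ?_ fun i ↦ (hf i).2
  · exact hcof ▸ (aleph0_lt_lift.2 ho).ne'
  · rwa [hcof, Cardinal.lift_id, Cardinal.lift_id]

theorem IsClubIn.inter {E' : Set Ordinal.{u}} (ho : ℵ₀ < o.cof) (hE : IsClubIn E o)
    (hE' : IsClubIn E' o) : IsClubIn (E ∩ E') o := by
  refine ⟨inter_subset_left.trans hE.1, IsClub.inter ?_ hE.2 hE'.2⟩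
  rw [Ordinal.cof_Iio, ← Ordinal.lift_cof]
  exact (aleph0_lt_lift.2 ho).ne'

end Topology

section Cofinality

theorem lt_cof_ord_succ {mu : Cardinal.{u}} (hmu : ℵ₀ ≤ mu) : mu < (Order.succ mu).ord.cof :=
  (Order.lt_succ mu).trans_eq (isRegular_succ hmu).cof_ord.symm

theorem exists_forall_le_of_lt_cof {ι : Type (u + 1)} {o : Ordinal.{u}}
    (hι : #ι < Cardinal.lift.{u + 1} o.cof) {f : ι → Ordinal.{u}} (hf : ∀ i, f i < o) :
    ∃ b < o, ∀ i, f i ≤ b := by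
  refine ⟨sSup (range f), Ordinal.sSup_lt_of_lt_cof ?_ (forall_mem_range.2 hf),
    fun i ↦ le_csSup ⟨o, forall_mem_range.2 fun j ↦ (hf j).le⟩ (mem_range_self i)⟩
  rw [← Ordinal.lift_cof]
  exact mk_range_le.trans_lt hι

theorem exists_isCofinal_preimage_Iic {α β : Type u} [LinearOrder α] [LinearOrder β]
    (hcof : Order.cof α ≠ Order.cof β) (f : α → β) : ∃ b, IsCofinal (f ⁻¹' Iic b) := by
  obtain hlt | hlt := hcof.lt_or_gt
  · obtain ⟨s, hs, hsα⟩ := Order.exists_cof_eq α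
    obtain ⟨b, hb⟩ := not_isCofinal_iff.1 fun h : IsCofinal (f '' s) ↦
      hlt.not_ge (hsα ▸ (Order.cof_le h).trans mk_image_le)
    exact ⟨b, hs.mono fun x hx ↦ (hb _ (mem_image_of_mem f hx)).le⟩
  · by_contra! hbdd
    simp only [not_isCofinal_iff] at hbdd
    choose x hx using hbdd
    obtain ⟨s, hs, hsβ⟩ := Order.exists_cof_eq β
    obtain ⟨y, hy⟩ := not_isCofinal_iff.1 fun h : IsCofinal (x '' s) ↦
      hlt.not_ge (hsβ ▸ (Order.cof_le h).trans mk_image_le)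
    obtain ⟨b, hb, hyb⟩ := hs (f y)
    exact (hx b y hyb).not_gt (hy _ (mem_image_of_mem x hb))

theorem exists_forall_exists_le_of_cof_ne {δ o : Ordinal.{u}} (hcof : δ.cof ≠ o.cof)
    {f : Ordinal.{u} → Ordinal.{u}} (hf : ∀ i < δ, f i < o) :
    ∃ b < o, ∀ i < δ, ∃ j < δ, i ≤ j ∧ f j ≤ b := by
  have hcof' : Order.cof (Iio δ) ≠ Order.cof (Iio o) := by
    simpa only [Ordinal.cof_Iio, ← Ordinal.lift_cof, ne_eq, Cardinal.lift_inj] using hcof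
  obtain ⟨b, hb⟩ := exists_isCofinal_preimage_Iic hcof' fun i ↦ ⟨f i, hf i i.2⟩
  refine ⟨b, b.2, fun i hi ↦ ?_⟩
  obtain ⟨j, hj, hij⟩ := hb ⟨i, hi⟩
  exact ⟨j, j.2, hij, hj⟩

end Cofinality

section Cardinality

variable {τ : Type (u + 1)} {c : Cardinal.{u}} {o : Ordinal.{u}}

theorem mk_Iio_lt (ho : o < c.ord) : #(Iio o) < Cardinal.lift.{u + 1} c := by
  rw [mk_Iio_ordinal, Cardinal.lift_lt]
  exact lt_ord.1 ho

theorem mk_image_Iio_lt (ho : o < c.ord) (f : Ordinal.{u} → τ) :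
    #(f '' Iio o) < Cardinal.lift.{u + 1} c :=
  mk_image_le.trans_lt (mk_Iio_lt ho)

theorem exists_subset_image_Iio [Nonempty τ] {T : Set τ} (hT : #T ≤ Cardinal.lift.{u + 1} c) :
    ∃ f : Ordinal.{u} → τ, T ⊆ f '' Iio c.ord := by
  obtain ⟨g⟩ : #T ≤ #(Iio c.ord) := by rwa [mk_Iio_ordinal, card_ord]
  have hg : Function.Injective fun x ↦ (g x : Ordinal) := Subtype.val_injective.comp g.injective
  exact ⟨Function.extend (fun x ↦ (g x : Ordinal)) (↑) fun _ ↦ Classical.arbitrary τ,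
    fun x hx ↦ ⟨g ⟨x, hx⟩, (g ⟨x, hx⟩).2, hg.extend_apply _ _ ⟨x, hx⟩⟩⟩

end Cardinality

section NormalFunction

variable {c f g : Ordinal.{u} → Ordinal.{u}} {i o δ β : Ordinal.{u}}

theorem image_Iio_inter_Iio (hc : StrictMono c) (hi : i ≤ δ) :
    c '' Iio δ ∩ Iio (c i) = c '' Iio i := by
  ext y
  constructor
  · rintro ⟨⟨j, -, rfl⟩, hji⟩
    exact ⟨j, hc.lt_iff_lt.1 hji, rfl⟩
  · rintro ⟨j, hj, rfl⟩
    exact ⟨⟨j, hj.trans_le hi, rfl⟩, hc hj⟩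

theorem otp_image_Iio (hc : StrictMono c) : otp (c '' Iio i) = Ordinal.lift.{u + 1} i := by
  rw [otp, ← Ordinal.type_lt_Iio]
  exact (((hc.strictMonoOn _).orderIso c (Iio i)).toRelIsoLT.ordinalType_congr).symm

theorem isClosedIn_image_Iio (hc : Order.IsNormal c) : IsClosedIn (c '' Iio i) (c i) := by
  have hsub : c '' Iio i ⊆ Iio (c i) := image_subset_iff.2 fun j hj ↦ hc.strictMono hj
  refine ⟨hsub, (isClosed_preimage_Iio_iff hsub).2 ?_⟩
  rintro x ⟨hx, hxi⟩
  have hclosed : IsClosed (range c) := dirSupClosed_iff_isClosed.1 hc.dirSupClosed_range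
  obtain ⟨j, rfl⟩ := closure_minimal (image_subset_range c _) hclosed hx
  exact ⟨j, hc.strictMono.lt_iff_lt.1 hxi, rfl⟩

theorem isClubIn_image_Iio (hc : Order.IsNormal c) (hi : Order.IsSuccLimit i) :
    IsClubIn (c '' Iio i) (c i) := by
  obtain ⟨hsub, hclosed⟩ := isClosedIn_image_Iio hc (i := i)
  refine isClubIn_iff.2 ⟨hsub, (isClosed_preimage_Iio_iff hsub).1 hclosed, fun x hx ↦ ?_⟩
  obtain ⟨j, hj, hxj⟩ := (hc.lt_iff_exists_lt hi).1 hx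
  exact ⟨c j, mem_image_of_mem c hj, hxj.le⟩

theorem exists_eq_of_mem_nacc_image_Iio (hc : Order.IsNormal c) (hβ : β ∈ nacc (c '' Iio δ)) :
    ∃ i < δ, ¬ Order.IsSuccLimit i ∧ β = c i := by
  obtain ⟨⟨i, hi, rfl⟩, hacc⟩ := hβ
  refine ⟨i, hi, fun hlim ↦ hacc (SuccOrder.accPt_principal.2 ⟨?_, fun x hx ↦ ?_⟩), rfl⟩
  · exact not_isMin_iff.2 ⟨_, hc.strictMono hlim.bot_lt⟩
  · obtain ⟨j, hj, hxj⟩ := (hc.lt_iff_exists_lt hlim).1 hx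
    exact ⟨c j, ⟨j, hj.trans hi, rfl⟩, hxj, hc.strictMono hj⟩

theorem exists_isSuccLimit_forall_exists_map_le {x : Ordinal.{u}} (ho : ℵ₀ < o.cof) (hx : x < o)
    (hlt : ∀ i < o, i < f i) (hf : ∀ i < o, f i < o) :
    ∃ z < o, x ≤ z ∧ Order.IsSuccLimit z ∧ ∀ i < z, ∃ j < o, i < j ∧ f j ≤ z := by
  have hz : Ordinal.nfp f x < o := Ordinal.nfp_lt_ord ho hf hx
  have hiter : ∀ i < Ordinal.nfp f x, ∃ j < o, i < j ∧ f j ≤ Ordinal.nfp f x := fun i hi ↦ by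
    obtain ⟨n, hn⟩ := Ordinal.lt_nfp_iff.1 hi
    refine ⟨_, (Ordinal.iterate_le_nfp f x n).trans_lt hz, hn, ?_⟩
    rw [← Function.iterate_succ_apply' f]
    exact Ordinal.iterate_le_nfp f x (n + 1)
  refine ⟨_, hz, Ordinal.le_nfp f x, ⟨?_, Order.isSuccPrelimit_of_succ_lt fun i hi ↦ ?_⟩, hiter⟩
  · exact not_isMin_iff.2 ⟨x, (hlt x hx).trans_le (Ordinal.iterate_le_nfp f x 1)⟩
  · obtain ⟨j, hj, hij, hle⟩ := hiter i hi
    exact (Order.succ_le_of_lt hij).trans_lt ((hlt j hj).trans_le hle)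

theorem IsClubIn.map_mem_of_mapsTo {E : Set Ordinal.{u}} (hE : IsClubIn E o)
    (hc : Order.IsNormal c) (hδ : Order.IsSuccLimit δ) (hcδ : c δ < o) (hcE : MapsTo c (Iio δ) E) :
    c δ ∈ E := by
  have hmem : c δ ∈ closure (c '' Iio δ) := (hc.isLUB_image_Iio_of_isSuccLimit hδ).mem_closure
    ⟨c 0, mem_image_of_mem c hδ.bot_lt⟩
  exact hE.closure_subset ⟨closure_mono hcE.image_subset hmem, hcδ⟩

theorem isClubIn_eqOn (hf : Order.IsNormal f) (hg : Order.IsNormal g) (ho : ℵ₀ < o.cof)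
    (h : f o = g o) : IsClubIn {i | i < o ∧ f i = g i} o := by
  have hlim : Order.IsSuccLimit o := Ordinal.one_lt_cof_iff.1 (one_lt_aleph0.trans ho)
  refine isClubIn_iff.2 ⟨fun i hi ↦ hi.1, fun i hi ↦ ⟨hi.2, ?_⟩, fun x hx ↦ ?_⟩
  · exact closure_minimal (fun j hj ↦ hj.2) (isClosed_eq hf.continuous hg.continuous) hi.1
  have hnext : ∀ i < o, ∃ j < o, i < j ∧ f i < g j ∧ g i < f j := fun i hi ↦ by
    obtain ⟨j, hj, hij⟩ := (hg.lt_iff_exists_lt hlim).1 (h ▸ hf.strictMono hi)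
    obtain ⟨k, hk, hik⟩ := (hf.lt_iff_exists_lt hlim).1 (h ▸ hg.strictMono hi)
    exact ⟨max (Order.succ i) (max j k), max_lt (hlim.succ_lt hi) (max_lt hj hk), by simp,
      hij.trans_le (hg.monotone (by simp)), hik.trans_le (hf.monotone (by simp))⟩
  choose! e he hlt hfg hgf using hnext
  obtain ⟨z, hz, hxz, hzlim, hez⟩ := exists_isSuccLimit_forall_exists_map_le ho hx hlt he
  refine ⟨z, ⟨hz, le_antisymm ?_ ?_⟩, hxz⟩
  · refine (hf.le_iff_forall_le hzlim).2 fun i hi ↦ ?_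
    obtain ⟨j, hj, hij, hle⟩ := hez i hi
    exact (hf.monotone hij.le).trans ((hfg j hj).le.trans (hg.monotone hle))
  · refine (hg.le_iff_forall_le hzlim).2 fun i hi ↦ ?_
    obtain ⟨j, hj, hij, hle⟩ := hez i hi
    exact (hg.monotone hij.le).trans ((hgf j hj).le.trans (hf.monotone hle))

end NormalFunction

section Stabilization

variable {mu : Cardinal.{u}} {o : Ordinal.{u}} {ι J : Type (u + 1)}

theorem exists_eqOn_succ_of_antitone {α : Type*} [PartialOrder α] [WellFoundedLT α]
    {F : Ordinal.{u} → J → α} (hF : Antitone F) {A : Set J} (hmu : ℵ₀ ≤ mu)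
    (hA : #A < Cardinal.lift.{u + 1} mu) :
    ∃ i < mu.ord, EqOn (F (Order.succ i)) (F i) A := by
  by_contra! hne
  have hmk : #(Iio mu.ord) = Cardinal.lift.{u + 1} mu := by rw [mk_Iio_ordinal, card_ord]
  have : Infinite (Iio mu.ord) := infinite_iff.2 (hmk ▸ aleph0_le_lift.2 hmu)
  have hx : ∀ i : Iio mu.ord, ∃ x : A, F (Order.succ i) x ≠ F i x := fun i ↦ by
    simpa [EqOn] using hne i i.2
  choose x hx using hx
  obtain ⟨a, ha⟩ := exists_infinite_fiber x (hmk ▸ hA)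
  have hanti : StrictAnti fun i : x ⁻¹' {a} ↦ F i a := fun i j hij ↦
    (hF (Order.succ_le_of_lt hij) a).trans_lt
      ((hF (Order.le_succ _) a).lt_of_ne (by simpa [show x i = a from i.2] using hx i))
  have : WellFoundedGT (x ⁻¹' {a}) := hanti.wellFoundedGT
  exact ha.not_finite (Finite.of_wellFoundedLT_wellFoundedGT _)

/-- The decreasing sequence of subsets of `o` obtained by iterating `Φ`, with intersections at
limit stages. -/
def descend (Φ : Set Ordinal.{u} → Set Ordinal.{u}) (o i : Ordinal.{u}) : Set Ordinal.{u} :=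
  Iio o ∩ ⋂ j : Iio i, Φ (descend Φ o j)
termination_by i
decreasing_by exact j.2

variable {Φ : Set Ordinal.{u} → Set Ordinal.{u}}

theorem descend_antitone : Antitone (descend Φ o) := fun i j hij ↦ by
  rw [descend, descend]
  exact inter_subset_inter_right _ fun x hx ↦ mem_iInter.2 fun k ↦
    mem_iInter.1 hx ⟨k, k.2.trans_le hij⟩

theorem descend_subset {i j : Ordinal.{u}} (hij : i < j) : descend Φ o j ⊆ Φ (descend Φ o i) := by
  rw [descend]
  exact inter_subset_right.trans (iInter_subset_of_subset ⟨i, hij⟩ subset_rfl)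

theorem isClubIn_descend (ho : ℵ₀ < o.cof) (hΦ : ∀ E, IsClubIn E o → IsClubIn (Φ E) o)
    {i : Ordinal.{u}} (hi : i < o.cof.ord) : IsClubIn (descend Φ o i) o := by
  induction i using WellFoundedLT.induction with
  | ind i ih =>
    rw [descend]
    exact isClubIn_Iio_inter_iInter ho (mk_Iio_lt hi) fun j ↦ hΦ _ (ih j j.2 (j.2.trans hi))

theorem exists_stable_club (hmu : ℵ₀ ≤ mu) (ho : mu < o.cof) {α : Type*} [PartialOrder α]
    [WellFoundedLT α] {r : Set Ordinal.{u} → J → α} (hr : Monotone r) {A : ι → Set J}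
    (hA : ∀ s, #(A s) < Cardinal.lift.{u + 1} mu) {G : ι → Set Ordinal.{u} → Prop}
    (hG : ∀ s, Monotone (G s)) (h : ∀ E, IsClubIn E o → ∃ s, G s E) :
    ∃ E', IsClubIn E' o ∧
      ∀ E, IsClubIn E o → E ⊆ E' → ∃ s, G s E ∧ EqOn (r E) (r E') (A s) := by
  by_contra! hne
  choose! Φ hΦ hΦsub hΦne using hne
  obtain ⟨s, hs⟩ := h _ (isClubIn_descend (hmu.trans_lt ho) hΦ (ord_lt_ord.2 ho))
  obtain ⟨i, hi, heq⟩ := exists_eqOn_succ_of_antitone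
    (hr.comp_antitone (descend_antitone (Φ := Φ) (o := o))) hmu (hA s)
  have hclub := isClubIn_descend (hmu.trans_lt ho) hΦ (hi.trans (ord_lt_ord.2 ho))
  refine hΦne _ hclub s (hG s (descend_subset hi) hs) fun x hx ↦ le_antisymm ?_ ?_
  · exact hr (hΦsub _ hclub) x
  · exact (heq hx).ge.trans (hr (descend_subset (Order.lt_succ i)) x)

theorem exists_forall_isClubIn (ho : ℵ₀ < o.cof) (hι : #ι < Cardinal.lift.{u + 1} o.cof)
    {Q : ι → Set Ordinal.{u} → Prop} (hQ : ∀ x, Monotone (Q x))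
    (h : ∀ E, IsClubIn E o → ∃ x, Q x E) : ∃ x, ∀ E, IsClubIn E o → Q x E := by
  by_contra! hne
  choose F hF hFQ using hne
  obtain ⟨x, hx⟩ := h _ (isClubIn_Iio_inter_iInter ho hι hF)
  exact hFQ x (hQ x (inter_subset_right.trans (iInter_subset F x)) hx)

end Stabilization

section CoherentFiltration

/-- The `i`-th approximation to `Iic β` obtained from enumerations `s β` of the ordinals below `β`:
besides `β`, it consists of the approximations at those among the first `i` values `s β k < β`
that contain all earlier values. -/
def filtration (s : Ordinal.{u} → Ordinal.{u} → Ordinal.{u}) (β i : Ordinal.{u}) :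
    Set Ordinal.{u} :=
  insert β {x | ∃ k ≤ i, ∃ _ : s β k < β,
    (∀ l < k, s β l < β → s β l ∈ filtration s (s β k) i) ∧ x ∈ filtration s (s β k) i}
termination_by β

variable {s : Ordinal.{u} → Ordinal.{u} → Ordinal.{u}} {β i x : Ordinal.{u}} {mu : Cardinal.{u}}

theorem mem_filtration : x ∈ filtration s β i ↔ x = β ∨ ∃ k ≤ i, s β k < β ∧
    (∀ l < k, s β l < β → s β l ∈ filtration s (s β k) i) ∧ x ∈ filtration s (s β k) i := by
  rw [filtration]
  simp only [mem_insert_iff, mem_ofPred_eq, exists_prop]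

theorem self_mem_filtration : β ∈ filtration s β i :=
  mem_filtration.2 (.inl rfl)

theorem filtration_subset_Iic : filtration s β i ⊆ Iic β := by
  induction β using WellFoundedLT.induction with
  | ind β ih =>
    intro x hx
    obtain rfl | ⟨k, -, hk, -, hx⟩ := mem_filtration.1 hx
    · exact self_mem_Iic
    · exact (ih _ hk hx).trans hk.le

theorem filtration_mono : Monotone (filtration s β) := by
  induction β using WellFoundedLT.induction with
  | ind β ih =>
    intro i j hij x hx
    refine mem_filtration.2 ((mem_filtration.1 hx).imp_right ?_)
    rintro ⟨k, hki, hk, hl, hx⟩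
    exact ⟨k, hki.trans hij, hk, fun l hlk h ↦ ih _ hk hij (hl l hlk h), ih _ hk hij hx⟩

theorem filtration_inter_Iic (hx : x ∈ filtration s β i) :
    filtration s β i ∩ Iic x = filtration s x i := by
  induction β using WellFoundedLT.induction generalizing x with
  | ind β ih =>
    obtain rfl | ⟨k, hki, hk, hadm, hxk⟩ := mem_filtration.1 hx
    · exact inter_eq_left.2 filtration_subset_Iic
    have hsub : filtration s (s β k) i ⊆ filtration s β i := fun y hy ↦
      mem_filtration.2 (.inr ⟨k, hki, hk, hadm, hy⟩)
    rw [← ih _ hk hxk]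
    refine (inter_subset_inter_left _ hsub).antisymm' ?_
    rintro y ⟨hy, hyx⟩
    have hyk : y ≤ s β k := (show y ≤ x from hyx).trans (filtration_subset_Iic hxk)
    obtain rfl | ⟨k', -, hk', hadm', hyk'⟩ := mem_filtration.1 hy
    · exact absurd hyk hk.not_ge
    refine ⟨?_, hyx⟩
    obtain h | rfl | h := lt_trichotomy k k'
    · exact (ih _ hk' (hadm' k h hk)).subset ⟨hyk', hyk⟩
    · exact hyk'
    · exact ((ih _ hk (hadm k' h hk')).superset hyk').1

theorem mk_filtration_lt (hmu : mu.IsRegular) (hi : i < mu.ord) :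
    #(filtration s β i) < Cardinal.lift.{u + 1} mu := by
  induction β using WellFoundedLT.induction with
  | ind β ih =>
    have hreg : (Cardinal.lift.{u + 1} mu).IsRegular := hmu.lift
    let K : Set Ordinal.{u} := {k | k ≤ i ∧ s β k < β}
    have hK : #K < Cardinal.lift.{u + 1} mu :=
      (mk_le_mk_of_subset fun k hk ↦ Order.lt_succ_iff.2 hk.1).trans_lt
        (mk_Iio_lt ((isSuccLimit_ord hmu.aleph0_le).succ_lt hi))
    have hsub : filtration s β i ⊆ {β} ∪ ⋃ k : K, filtration s (s β k) i := fun x hx ↦ by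
      obtain rfl | ⟨k, hki, hk, -, hx⟩ := mem_filtration.1 hx
      · exact .inl rfl
      · exact .inr (mem_iUnion.2 ⟨⟨k, hki, hk⟩, hx⟩)
    refine (mk_le_mk_of_subset hsub).trans_lt ((mk_union_le _ _).trans_lt ?_)
    refine add_lt_of_lt hreg.aleph0_le ?_ ?_
    · simpa using one_lt_aleph0.trans_le hreg.aleph0_le
    · exact (card_iUnion_lt_iff_forall_of_isRegular hreg hK).2 fun k ↦ ih _ k.2.2

theorem exists_mem_filtration (hmu : mu.IsRegular)
    (hs : ∀ β < (Order.succ mu).ord, Iio β ⊆ s β '' Iio mu.ord) (hβ : β < (Order.succ mu).ord)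
    (hx : x ≤ β) : ∃ i < mu.ord, x ∈ filtration s β i := by
  induction β using WellFoundedLT.induction generalizing x with
  | ind β ih =>
    obtain rfl | hxβ := hx.eq_or_lt
    · exact ⟨0, hmu.ord_pos, self_mem_filtration⟩
    -- For the least `k` with `x ≤ s β k < β`, all earlier values below `β` are even below `x`.
    obtain ⟨k, ⟨hk, hxk, hkβ⟩, hmin⟩ :
        ∃ k, Minimal (fun k ↦ k < mu.ord ∧ x ≤ s β k ∧ s β k < β) k :=
      exists_minimal_of_wellFoundedLT _ <| by
        obtain ⟨k, hk, rfl⟩ := hs β hβ hxβ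
        exact ⟨k, hk, le_rfl, hxβ⟩
    have hearlier : ∀ l < k, s β l < β → s β l < x := fun l hl hlβ ↦
      lt_of_not_ge fun hxl ↦ (hmin ⟨hl.trans hk, hxl, hlβ⟩ hl.le).not_gt hl
    have hcover : ∀ y, y ≤ s β k → ∃ i < mu.ord, y ∈ filtration s (s β k) i := fun y hy ↦
      ih _ hkβ (hkβ.trans hβ) hy
    choose! I hI hmem using hcover
    obtain ⟨b, hb, hIb⟩ : ∃ b < mu.ord, ∀ l : {l // l < k ∧ s β l < x}, I (s β l) ≤ b := by
      refine exists_forall_le_of_lt_cof ?_ fun l ↦ hI _ (l.2.2.le.trans hxk)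
      rw [hmu.cof_ord]
      exact (mk_le_mk_of_subset fun l hl ↦ hl.1).trans_lt (mk_Iio_lt hk)
    refine ⟨max k (max b (I x)), max_lt hk (max_lt hb (hI x hxk)), mem_filtration.2 <| .inr
      ⟨k, le_max_left _ _, hkβ, fun l hl hlβ ↦ ?_, filtration_mono (by simp) (hmem x hxk)⟩⟩
    have hlx := hearlier l hl hlβ
    exact filtration_mono (le_max_of_le_right (le_max_of_le_left (hIb ⟨l, hl, hlx⟩)))
      (hmem _ (hlx.le.trans hxk))

end CoherentFiltration

section Thinning

/-- A recursively constructed normal enumeration of part of `E ∪ Ici o`, whose value at `i` exceeds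
the bounds `B l` computed from the values up to `l`, for all `l < i`. -/
noncomputable def thinning (E : Set Ordinal.{u}) (o : Ordinal.{u})
    (B : (l : Ordinal.{u}) → (Iic l → Ordinal.{u}) → Ordinal.{u}) (i : Ordinal.{u}) : Ordinal.{u} :=
  sInf {x ∈ E ∪ Ici o | ∀ l : Iio i, thinning E o B l < x ∧
    B l (fun k : Iic l.1 ↦ thinning E o B k) < x}
termination_by i
decreasing_by
  · exact l.2
  · exact k.2.trans_lt l.2

variable {E : Set Ordinal.{u}} {o : Ordinal.{u}}
  {B : (l : Ordinal.{u}) → (Iic l → Ordinal.{u}) → Ordinal.{u}} {i x : Ordinal.{u}}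

theorem thinning_le (hx : x ∈ E ∪ Ici o) (h : ∀ l < i, thinning E o B l < x ∧
    B l (fun k ↦ thinning E o B k) < x) : thinning E o B i ≤ x := by
  rw [thinning]
  exact csInf_le' ⟨hx, fun l ↦ h l l.2⟩

theorem thinning_spec : thinning E o B i ∈ E ∪ Ici o ∧ ∀ l < i,
    thinning E o B l < thinning E o B i ∧ B l (fun k ↦ thinning E o B k) < thinning E o B i := by
  obtain ⟨b, hb⟩ : BddAbove (range fun l : Iio i ↦
    max (thinning E o B l) (B l fun k ↦ thinning E o B k)) := Ordinal.bddAbove_of_small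
  have hb' : ∀ l : Iio i, _ := fun l ↦ max_le_iff.1 (hb (mem_range_self l))
  have hmem := csInf_mem (s := {x ∈ E ∪ Ici o | ∀ l : Iio i, thinning E o B l < x ∧
    B l (fun k : Iic l.1 ↦ thinning E o B k) < x})
    ⟨max o (Order.succ b), .inr (mem_Ici.2 (le_max_left _ _)), fun l ↦ ⟨?_, ?_⟩⟩
  · rw [thinning]
    exact ⟨hmem.1, fun l hl ↦ hmem.2 ⟨l, hl⟩⟩
  · exact lt_max_of_lt_right (Order.lt_succ_iff.2 (hb' l).1)
  · exact lt_max_of_lt_right (Order.lt_succ_iff.2 (hb' l).2)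

theorem isNormal_thinning (hE : IsClubIn E o) : Order.IsNormal (thinning E o B) := by
  have hmono : StrictMono (thinning E o B) := fun l i hli ↦ (thinning_spec.2 l hli).1
  refine Order.isNormal_iff.2 ⟨hmono, fun i hi a ha ↦ ?_⟩
  have hbdd : BddAbove (thinning E o B '' Iio i) := ⟨a, forall_mem_image.2 ha⟩
  have hlt : ∀ l < i, thinning E o B (Order.succ l) ≤ sSup (thinning E o B '' Iio i) :=
    fun l hl ↦ le_csSup hbdd (mem_image_of_mem _ (hi.succ_lt hl))
  have hclosed : closure (E ∪ Ici o) ⊆ E ∪ Ici o := by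
    rw [closure_union, isClosed_Ici.closure_eq]
    exact fun x hx ↦ (lt_or_ge x o).imp
      (fun h ↦ hE.closure_subset ⟨hx.resolve_right (notMem_Ici.2 h), h⟩) id
  refine (thinning_le (hclosed ?_) fun l hl ↦ ?_).trans
    (csSup_le (hi.nonempty_Iio.image _) (forall_mem_image.2 ha))
  · exact closure_mono (image_subset_iff.2 fun l _ ↦ thinning_spec.1)
      (csSup_mem_closure (hi.nonempty_Iio.image _) hbdd)
  · have h := (thinning_spec (E := E) (o := o) (B := B)).2 l (Order.lt_succ l)
    exact ⟨h.1.trans_le (hlt l hl), h.2.trans_le (hlt l hl)⟩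

theorem thinning_lt {lam : Cardinal.{u}} (hlam : lam.IsRegular) (hE : IsClubIn E lam.ord)
    (hB : ∀ l g, B l g < lam.ord) (hi : i < lam.ord) : thinning E lam.ord B i < lam.ord := by
  induction i using WellFoundedLT.induction with
  | ind i ih =>
    obtain ⟨b, hb, hle⟩ := exists_forall_le_of_lt_cof (o := lam.ord)
      (f := fun l : Iio i ↦ max (thinning E lam.ord B l) (B l fun k ↦ thinning E lam.ord B k))
      (by rw [hlam.cof_ord]; exact mk_Iio_lt hi) fun l ↦ max_lt (ih l l.2 (l.2.trans hi)) (hB _ _)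
    obtain ⟨y, hy, hby⟩ := hE.exists_gt (isSuccLimit_ord hlam.aleph0_le) hb
    refine (thinning_le (.inl hy) fun l hl ↦ ?_).trans_lt (hE.1 hy)
    exact max_lt_iff.1 ((hle ⟨l, hl⟩).trans_lt hby)

theorem exists_isNormal_mapsTo_isClubIn {lam : Cardinal.{u}} (hlam : lam.IsRegular)
    (hE : IsClubIn E lam.ord) (B : (l : Ordinal.{u}) → (Iic l → Ordinal.{u}) → Ordinal.{u})
    (hB : ∀ l g, B l g < lam.ord) : ∃ f : Ordinal.{u} → Ordinal.{u}, Order.IsNormal f ∧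
      MapsTo f (Iio lam.ord) E ∧ ∀ l, B l (fun k ↦ f k) < f (Order.succ l) :=
  ⟨thinning E lam.ord B, isNormal_thinning hE,
    fun _ hi ↦ thinning_spec.1.resolve_right (notMem_Ici.2 (thinning_lt hlam hE hB hi)),
    fun l ↦ (thinning_spec.2 l (Order.lt_succ l)).2⟩

end Thinning

section Enumeration

variable {X : Set Ordinal.{u}} {γ δ x y : Ordinal.{u}} {e : Ordinal.{u} → Ordinal.{u}}

theorem mem_of_isLeast_closure_inter_Ioi (hy : IsLeast (closure X ∩ Ioi x) y) : y ∈ X := by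
  obtain ⟨z, ⟨hxz, hzy⟩, hz⟩ := mem_closure_iff.1 hy.1.1 (Ioi x ∩ Iic y)
    (isOpen_Ioi.inter (isLowerSet_Iic y).isOpen) ⟨hy.1.2, self_mem_Iic⟩
  exact (show z ≤ y from hzy).antisymm (hy.2 ⟨subset_closure hz, hxz⟩) ▸ hz

theorem exists_isNormal_mapsTo_closure (hX : X ⊆ Iic γ) (he : StrictMonoOn e (Iio δ))
    (heX : MapsTo e (Iio δ) X) : ∃ c : Ordinal.{u} → Ordinal.{u}, Order.IsNormal c ∧
      c δ ≤ Order.succ γ ∧ MapsTo c (Iio δ) (closure X) ∧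
      ∀ i, Order.succ i < δ → c (Order.succ i) ∈ X ∧
        c '' Iic i = closure X ∩ Iio (c (Order.succ i)) := by
  let Y := closure X ∪ Ici (Order.succ γ)
  have hY : ¬ BddAbove Y := fun h ↦ not_bddAbove_Ici _ (h.mono subset_union_right)
  have hYc : IsClosed Y := isClosed_closure.union isClosed_Ici
  have hc : Order.IsNormal (Ordinal.enumOrd Y) := Ordinal.isNormal_enumOrd
    (fun t ht hne hbdd ↦ hYc.closure_subset_iff.2 ht (csSup_mem_closure hne hbdd)) hY
  have hle : ∀ i < δ, Ordinal.enumOrd Y i ≤ e i := fun i ↦ by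
    induction i using WellFoundedLT.induction with
    | ind i ih =>
      exact fun hi ↦ Ordinal.enumOrd_le_of_forall_lt (.inl (subset_closure (heX hi))) fun j hj ↦
        (ih j hj (hj.trans hi)).trans_lt (he (hj.trans hi) hi hj)
  have hleγ : ∀ i < δ, Ordinal.enumOrd Y i ≤ γ := fun i hi ↦ (hle i hi).trans (hX (heX hi))
  have hmem : MapsTo (Ordinal.enumOrd Y) (Iio δ) (closure X) := fun i hi ↦
    (Ordinal.enumOrd_mem hY i).resolve_right
      (notMem_Ici.2 (Order.lt_succ_of_le (hleγ i hi)))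
  refine ⟨_, hc, Ordinal.enumOrd_le_of_forall_lt (.inr self_mem_Ici) fun i hi ↦
    Order.lt_succ_of_le (hleγ i hi), hmem, fun i hi ↦ ?_⟩
  refine ⟨mem_of_isLeast_closure_inter_Ioi ⟨⟨hmem hi, hc.strictMono (Order.lt_succ i)⟩,
    fun y hy ↦ Ordinal.enumOrd_succ_le hY (.inl hy.1) hy.2⟩, subset_antisymm ?_ ?_⟩
  · rintro _ ⟨j, hj, rfl⟩
    have hj' : j < Order.succ i := Order.lt_succ_iff.2 hj
    exact ⟨hmem (hj'.trans hi), hc.strictMono hj'⟩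
  · rintro y ⟨hy, hyi⟩
    obtain ⟨j, rfl⟩ := Ordinal.enumOrd_surjective hY (.inl hy)
    exact ⟨j, Order.lt_succ_iff.1 (hc.strictMono.lt_iff_lt.1 hyi), rfl⟩

end Enumeration

section GuessSystem

/-- A ladder of length `δ` for `P`: the normal function `c` lists a closed set `c '' Iio δ`, whose
initial segments below successor-indexed members are prescribed by `P`. Only the values of `c` up
to `δ` matter. -/
structure IsLadder (P : Ordinal.{u} → Set (Set Ordinal.{u})) (δ : Ordinal.{u})
    (c : Ordinal.{u} → Ordinal.{u}) : Prop where
  normal : Order.IsNormal c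
  coherent : ∀ i, Order.succ i < δ → c '' Iic i ∈ P (c (Order.succ i))

/-- The families `P β`, for `β < lam`, are small, yet every club of `lam` includes a bounded ladder
of length `δ` for `P`. In contrast with `GuessesClubs`, many ladders may share a supremum. -/
structure IsGuessSystem (lam : Cardinal.{u}) (δ : Ordinal.{u})
    (P : Ordinal.{u} → Set (Set Ordinal.{u})) : Prop where
  mk_lt : ∀ β < lam.ord, #(P β) < Cardinal.lift.{u + 1} lam
  exists_ladder : ∀ E, IsClubIn E lam.ord →
    ∃ c, IsLadder P δ c ∧ c δ < lam.ord ∧ MapsTo c (Iio δ) E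

end GuessSystem

section RegularCase

/-- The points `y` of `E` that are the largest element of `E` below or equal to some point
of `A`. -/
def floorSet (E A : Set Ordinal.{u}) : Set Ordinal.{u} :=
  {y | ∃ x ∈ A, IsGreatest (E ∩ Iic x) y}

/-- The family prescribed at `β`: it consists of the traces on `β` of the closures of the sets of
floors in `E` of the sets `A x i`, where `i < κ` and `β` is the floor of `x`. -/
def floorSystem (E : Set Ordinal.{u}) (A : Ordinal.{u} → Ordinal.{u} → Set Ordinal.{u})
    (κ β : Ordinal.{u}) : Set (Set Ordinal.{u}) :=
  {Q | ∃ x, ∃ i < κ, IsGreatest (E ∩ Iic x) β ∧ Q = closure (floorSet E (A x i)) ∩ Iio β}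

variable {A E E' : Set Ordinal.{u}} {γ δ i x y β : Ordinal.{u}} {mu lam : Cardinal.{u}}

theorem inter_subset_floorSet : A ∩ E ⊆ floorSet E A := fun x hx ↦
  ⟨x, hx.1, ⟨hx.2, self_mem_Iic⟩, fun _ hy ↦ hy.2⟩

theorem floorSet_subset_Iic (hA : A ⊆ Iic γ) : floorSet E A ⊆ Iic γ := fun _ ⟨_, hx, hy⟩ ↦
  mem_Iic.2 (le_trans hy.1.2 (hA hx))

theorem floorSet_inter_Iic (hy : IsGreatest (E ∩ Iic x) y) :
    floorSet E (A ∩ Iic x) ∩ Iio y = floorSet E A ∩ Iio y := by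
  ext z
  refine and_congr_left fun hzy ↦ ⟨fun ⟨w, hw, hz⟩ ↦ ⟨w, hw.1, hz⟩, fun ⟨w, hw, hz⟩ ↦
    ⟨w, ⟨hw, mem_Iic.2 (le_of_not_gt fun hxw ↦ ?_)⟩, hz⟩⟩
  exact (hz.2 ⟨hy.1.1, hy.1.2.trans hxw.le⟩).not_gt hzy

theorem closure_inter_Iio_congr {X Y : Set Ordinal.{u}} (h : X ∩ Iio y = Y ∩ Iio y) :
    closure X ∩ Iio y = closure Y ∩ Iio y := by
  have hsub : ∀ {X Y : Set Ordinal.{u}}, X ∩ Iio y = Y ∩ Iio y →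
      closure X ∩ Iio y ⊆ closure Y := fun h ↦ by
    rw [inter_comm]
    refine isOpen_Iio.inter_closure.trans (closure_mono ?_)
    rw [inter_comm, h]
    exact inter_subset_left
  exact (subset_inter (hsub h) inter_subset_right).antisymm
    (subset_inter (hsub h.symm) inter_subset_right)

/-- The successor of the floor of `x` in `E`, or `0` if `x` has no floor. It is monotone in `E`,
unlike the floor itself, for which no default value would distinguish the floor `0` from its
absence. -/
noncomputable def succFloor (E : Set Ordinal.{u}) (x : Ordinal.{u}) : Ordinal.{u} :=
  sSup (Order.succ '' (E ∩ Iic x))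

theorem bddAbove_succ_image : BddAbove (Order.succ '' (E ∩ Iic x)) :=
  ⟨Order.succ x, forall_mem_image.2 fun _ hy ↦ Order.succ_le_succ hy.2⟩

theorem succFloor_mono : Monotone (succFloor : Set Ordinal.{u} → Ordinal.{u} → Ordinal.{u}) :=
  fun _ _ h _ ↦ csSup_le_csSup' bddAbove_succ_image (image_mono (inter_subset_inter_left _ h))

theorem mem_of_succFloor_eq (hE : E ⊆ E') (h : succFloor E x = succFloor E' x)
    (hy : IsGreatest (E' ∩ Iic x) y) : y ∈ E := by
  have hlt : y < succFloor E x := (Order.lt_succ y).trans_le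
    (h ▸ le_csSup bddAbove_succ_image (mem_image_of_mem _ hy.1))
  obtain ⟨_, ⟨z, hz, rfl⟩, hyz⟩ := exists_lt_of_lt_csSup' hlt
  obtain rfl := (Order.lt_succ_iff.1 hyz).antisymm (hy.2 ⟨hE hz.1, hz.2⟩)
  exact hz.1

theorem mk_floorSystem_lt {A : Ordinal.{u} → Ordinal.{u} → Set Ordinal.{u}} (hlam : ℵ₀ ≤ lam)
    (hE : IsClubIn E lam.ord) {κ : Ordinal.{u}} (hκ : κ < lam.ord) (hβ : β < lam.ord) :
    #(floorSystem E A κ β) < Cardinal.lift.{u + 1} lam := by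
  obtain ⟨b, hb, hβb⟩ := hE.exists_gt (isSuccLimit_ord hlam) hβ
  let Q (p : Ordinal.{u} × Ordinal.{u}) := closure (floorSet E (A p.1 p.2)) ∩ Iio β
  have hsub : floorSystem E A κ β ⊆ Q '' (Iio b ×ˢ Iio κ) := by
    rintro _ ⟨x, i, hi, hx, rfl⟩
    refine ⟨(x, i), ⟨mem_Iio.2 (lt_of_not_ge fun hbx ↦ ?_), hi⟩, rfl⟩
    exact (hx.2 ⟨hb, hbx⟩).not_gt hβb
  refine (mk_le_mk_of_subset hsub).trans_lt (mk_image_le.trans_lt ?_)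
  rw [mk_setProd]
  exact mul_lt_of_lt (aleph0_le_lift.2 hlam) (mk_Iio_lt (hE.1 hb)) (mk_Iio_lt hκ)

theorem exists_enumeration_Iio (mu : Cardinal.{u}) : ∃ s : Ordinal.{u} → Ordinal.{u} → Ordinal.{u},
    ∀ β < (Order.succ mu).ord, Iio β ⊆ s β '' Iio mu.ord := by
  have h : ∀ β < (Order.succ mu).ord, ∃ s : Ordinal.{u} → Ordinal.{u}, Iio β ⊆ s '' Iio mu.ord :=
    fun β hβ ↦ exists_subset_image_Iio <| by
      rw [mk_Iio_ordinal, Cardinal.lift_le]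
      exact Order.lt_succ_iff.1 (lt_ord.1 hβ)
  choose! s hs using h
  exact ⟨s, hs⟩

theorem exists_strictMonoOn_mapsTo_filtration {s : Ordinal.{u} → Ordinal.{u} → Ordinal.{u}}
    (hmu : mu.IsRegular) (hδ : δ.card < mu)
    (hs : ∀ β < (Order.succ mu).ord, Iio β ⊆ s β '' Iio mu.ord)
    (hE : IsClubIn E (Order.succ mu).ord) : ∃ γ < (Order.succ mu).ord, ∃ i < mu.ord,
      ∃ e : Ordinal.{u} → Ordinal.{u}, StrictMonoOn e (Iio δ) ∧
        MapsTo e (Iio δ) (filtration s γ i ∩ E) := by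
  have hδ' : δ < (Order.succ mu).ord := lt_ord.2 (hδ.trans (Order.lt_succ mu))
  obtain ⟨f, hf, hfE, -⟩ := exists_isNormal_mapsTo_isClubIn (isRegular_succ hmu.aleph0_le) hE
    (fun _ _ ↦ 0) fun _ _ ↦ (isRegular_succ hmu.aleph0_le).ord_pos
  have hγ : f δ < (Order.succ mu).ord := hE.1 (hfE hδ')
  have hcover : ∀ j : Iio δ, ∃ i < mu.ord, f j ∈ filtration s (f δ) i := fun j ↦
    exists_mem_filtration hmu hs hγ (hf.monotone j.2.le)
  choose I hI hmem using hcover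
  obtain ⟨i, hi, hIi⟩ := exists_forall_le_of_lt_cof
    (by rw [hmu.cof_ord]; exact mk_Iio_lt (lt_ord.2 hδ)) hI
  exact ⟨f δ, hγ, i, hi, f, hf.strictMono.strictMonoOn _, fun j hj ↦
    ⟨filtration_mono (hIi ⟨j, hj⟩) (hmem ⟨j, hj⟩), hfE (hj.trans hδ')⟩⟩

theorem exists_isLadder_floorSystem {A : Ordinal.{u} → Ordinal.{u} → Set Ordinal.{u}}
    (hlam : ℵ₀ ≤ lam) (hA : A γ i ⊆ Iic γ) (hcoh : ∀ x ∈ A γ i, A γ i ∩ Iic x = A x i)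
    (hγ : γ < lam.ord) {κ : Ordinal.{u}} (hi : i < κ) {e : Ordinal.{u} → Ordinal.{u}}
    (he : StrictMonoOn e (Iio δ)) (heA : MapsTo e (Iio δ) (A γ i ∩ E)) :
    ∃ c, IsLadder (floorSystem E A κ) δ c ∧ c δ < lam.ord ∧
      MapsTo c (Iio δ) (closure (floorSet E (A γ i))) := by
  obtain ⟨c, hc, hcδ, hcE, hcsucc⟩ := exists_isNormal_mapsTo_closure (floorSet_subset_Iic hA) he
    (heA.mono_right inter_subset_floorSet)
  refine ⟨c, ⟨hc, fun j hj ↦ ?_⟩, hcδ.trans_lt ((isSuccLimit_ord hlam).succ_lt hγ), hcE⟩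
  obtain ⟨⟨x, hx, hgreatest⟩, himage⟩ := hcsucc j hj
  refine ⟨x, i, hi, hgreatest, himage.trans (closure_inter_Iio_congr ?_)⟩
  rw [← hcoh x hx, floorSet_inter_Iic hgreatest]

theorem exists_isGuessSystem_of_isRegular (hmu : mu.IsRegular) (hδ : δ.card < mu) :
    ∃ P, IsGuessSystem (Order.succ mu) δ P := by
  have hlam : (Order.succ mu).IsRegular := isRegular_succ hmu.aleph0_le
  obtain ⟨s, hs⟩ := exists_enumeration_Iio mu
  obtain ⟨E', hE', hstable⟩ := exists_stable_club (mu := mu) (o := (Order.succ mu).ord)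
    (ι := Iio (Order.succ mu).ord × Iio mu.ord) hmu.aleph0_le
    (lt_cof_ord_succ hmu.aleph0_le) succFloor_mono
    (A := fun p ↦ filtration s p.1 p.2) (fun p ↦ mk_filtration_lt hmu p.2.2)
    (G := fun p E ↦ ∃ e : Ordinal.{u} → Ordinal.{u}, StrictMonoOn e (Iio δ) ∧
      MapsTo e (Iio δ) (filtration s p.1 p.2 ∩ E))
    (fun p E F hEF ⟨e, he, heE⟩ ↦ ⟨e, he, heE.mono_right (inter_subset_inter_right _ hEF)⟩)
    fun E hE ↦ by
      obtain ⟨γ, hγ, i, hi, he⟩ := exists_strictMonoOn_mapsTo_filtration hmu hδ hs hE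
      exact ⟨(⟨γ, hγ⟩, ⟨i, hi⟩), he⟩
  refine ⟨floorSystem E' (filtration s) mu.ord, fun β hβ ↦ mk_floorSystem_lt hlam.aleph0_le hE'
    (ord_lt_ord.2 (Order.lt_succ mu)) hβ, fun E hE ↦ ?_⟩
  have hcof : ℵ₀ < (Order.succ mu).ord.cof :=
    hmu.aleph0_le.trans_lt (lt_cof_ord_succ hmu.aleph0_le)
  obtain ⟨⟨⟨γ, hγ⟩, ⟨i, hi⟩⟩, ⟨e, he, heE⟩, hfloor⟩ :=
    hstable _ (hE'.inter hcof hE) inter_subset_left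
  obtain ⟨c, hc, hcδ, hcE⟩ := exists_isLadder_floorSystem hlam.aleph0_le filtration_subset_Iic
    (fun x ↦ filtration_inter_Iic) hγ hi he
    (heE.mono_right (inter_subset_inter_right _ inter_subset_left))
  refine ⟨c, hc, hcδ, fun j hj ↦ hE.closure_subset ⟨closure_mono ?_ (hcE hj),
    (hc.normal.strictMono hj).trans hcδ⟩⟩
  rintro y ⟨x, hx, hy⟩
  exact (mem_of_succFloor_eq inter_subset_left (hfloor hx) hy).2

end RegularCase

section Transfer

variable {σ lam mu : Cardinal.{u}} {δ : Ordinal.{u}} {E : Set Ordinal.{u}}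

theorem exists_isNormal_image_mem_image_Iio (hlam : lam.IsRegular) {𝒬 : Set (Set Ordinal.{u})}
    (h𝒬 : #𝒬 < Cardinal.lift.{u + 1} lam) (t : Ordinal.{u} → Set Ordinal.{u})
    (hE : IsClubIn E lam.ord) : ∃ f : Ordinal.{u} → Ordinal.{u}, Order.IsNormal f ∧
      MapsTo f (Iio lam.ord) E ∧ ∀ Q ∈ 𝒬, ∀ l, Q ⊆ Iic l → f '' Q ∈ t '' Iio lam.ord →
        f '' Q ∈ t '' Iio (f (Order.succ l)) := by
  have hidx : ∀ R : Set Ordinal.{u}, ∃ η < lam.ord, R ∈ t '' Iio lam.ord → t η = R := fun R ↦ by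
    by_cases hR : R ∈ t '' Iio lam.ord
    · obtain ⟨η, hη, hηR⟩ := hR
      exact ⟨η, hη, fun _ ↦ hηR⟩
    · exact ⟨0, hlam.ord_pos, fun h ↦ absurd h hR⟩
  choose idx hidx htidx using hidx
  have hbound : ∀ l (g : Iic l → Ordinal.{u}), ∃ b < lam.ord,
      ∀ Q : 𝒬, idx (g '' (Subtype.val ⁻¹' Q.1)) ≤ b := fun l g ↦
    exists_forall_le_of_lt_cof (by rwa [hlam.cof_ord]) fun Q ↦ hidx _
  choose B hB hle using hbound
  obtain ⟨f, hf, hfE, hfB⟩ := exists_isNormal_mapsTo_isClubIn hlam hE B hB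
  refine ⟨f, hf, hfE, fun Q hQ l hQl hfQ ↦ ⟨_, (hle l (fun k ↦ f k) ⟨Q, hQ⟩).trans_lt (hfB l), ?_⟩⟩
  have himage : (fun k : Iic l ↦ f k) '' (Subtype.val ⁻¹' Q) = f '' Q := by
    rw [← Function.comp_def, image_comp, Subtype.image_preimage_coe,
      inter_eq_self_of_subset_right hQl]
  rw [himage, htidx _ hfQ]

theorem IsGuessSystem.mk_iUnion_le {P : Ordinal.{u} → Set (Set Ordinal.{u})} (hσ : ℵ₀ ≤ σ)
    (hP : IsGuessSystem σ δ P) : #(⋃ β : Iio σ.ord, P β) ≤ Cardinal.lift.{u + 1} σ := by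
  refine mk_iUnion_le_sum_mk.trans ((sum_le_sum _ (fun _ ↦ Cardinal.lift.{u + 1} σ)
    fun β : Iio σ.ord ↦ (hP.mk_lt β β.2).le).trans ?_)
  rw [sum_const', mk_Iio_ordinal, card_ord, mul_eq_self (aleph0_le_lift.2 hσ)]

theorem IsGuessSystem.exists_of_lt {P : Ordinal.{u} → Set (Set Ordinal.{u})}
    (hP : IsGuessSystem σ δ P) (hσ : σ.IsRegular) (hσ' : ℵ₀ < σ) (hlam : lam.IsRegular)
    (hσlam : σ < lam) : ∃ R, IsGuessSystem lam δ R := by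
  -- `e γ` is chosen before the club `E`: the normal function that `E` yields below agrees with it
  -- on a club of `σ.ord`.
  choose! e he heσ using fun (γ : Ordinal.{u})
    (h : ∃ e : Ordinal.{u} → Ordinal.{u}, Order.IsNormal e ∧ e σ.ord = γ) ↦ h
  let 𝒬 : Set (Set Ordinal.{u}) := ⋃ β : Iio σ.ord, P β
  have h𝒬 : #𝒬 ≤ Cardinal.lift.{u + 1} σ := hP.mk_iUnion_le hσ.aleph0_le
  obtain ⟨t, ht⟩ : ∃ t : Ordinal.{u} → Set Ordinal.{u},
      (fun p : Ordinal.{u} × Set Ordinal.{u} ↦ e p.1 '' p.2) '' (Iio lam.ord ×ˢ 𝒬) ⊆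
        t '' Iio lam.ord := by
    refine exists_subset_image_Iio (mk_image_le.trans ?_)
    rw [mk_setProd, mk_Iio_ordinal, card_ord]
    exact mul_le_of_le (aleph0_le_lift.2 hlam.aleph0_le) le_rfl
      (h𝒬.trans (Cardinal.lift_le.2 hσlam.le))
  refine ⟨fun β ↦ t '' Iio β, fun β hβ ↦ mk_image_Iio_lt hβ t, fun E hE ↦ ?_⟩
  obtain ⟨f, hf, hfE, hft⟩ := exists_isNormal_image_mem_image_Iio hlam
    (h𝒬.trans_lt (Cardinal.lift_lt.2 hσlam)) t hE
  have hγ : f σ.ord < lam.ord := hE.1 (hfE (ord_lt_ord.2 hσlam))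
  have hclub : IsClubIn {i | i < σ.ord ∧ f i = e (f σ.ord) i} σ.ord :=
    isClubIn_eqOn hf (he _ ⟨f, hf, rfl⟩) (by rwa [hσ.cof_ord]) (heσ _ ⟨f, hf, rfl⟩).symm
  obtain ⟨c, hc, hcδ, hcE⟩ := hP.exists_ladder _ hclub
  refine ⟨f ∘ c, ⟨hf.comp hc.normal, fun i hi ↦ ?_⟩, (hf.strictMono hcδ).trans hγ,
    fun i hi ↦ hfE ((hcE hi).1.trans (ord_lt_ord.2 hσlam))⟩
  have hmem : c '' Iic i ∈ 𝒬 := mem_iUnion.2 ⟨⟨_, (hcE hi).1⟩, hc.coherent i hi⟩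
  have hsub : c '' Iic i ⊆ Iic (c i) := image_subset_iff.2 fun j hj ↦ hc.normal.monotone hj
  have hfe : f '' (c '' Iic i) = e (f σ.ord) '' (c '' Iic i) := by
    refine image_congr ?_
    rintro _ ⟨j, hj, rfl⟩
    exact (hcE ((Order.lt_succ_of_le (mem_Iic.1 hj)).trans hi)).2
  rw [image_comp]
  refine image_mono (Iio_subset_Iio (hf.monotone ?_)) (hft _ hmem _ hsub (ht ?_))
  · exact Order.succ_le_of_lt (hc.normal.strictMono (Order.lt_succ i))
  · exact ⟨(f σ.ord, c '' Iic i), ⟨hγ, hmem⟩, hfe.symm⟩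

theorem exists_isGuessSystem (hinf : ℵ₀ ≤ δ.card) (hδ : δ.card < mu) :
    ∃ P, IsGuessSystem (Order.succ mu) δ P := by
  have hreg : (Order.succ δ.card).IsRegular := isRegular_succ hinf
  obtain h | h := (Order.succ_le_of_lt hδ).eq_or_lt
  · exact exists_isGuessSystem_of_isRegular (h ▸ hreg) hδ
  · obtain ⟨P, hP⟩ := exists_isGuessSystem_of_isRegular hreg (Order.lt_succ δ.card)
    exact hP.exists_of_lt (isRegular_succ hreg.aleph0_le)
      (hreg.aleph0_le.trans_lt (Order.lt_succ _)) (isRegular_succ (hinf.trans hδ.le))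
      ((Order.succ_le_of_lt h).trans_lt (Order.lt_succ mu))

end Transfer

section SingleLadder

variable {P : Ordinal.{u} → Set (Set Ordinal.{u})} {mu : Cardinal.{u}} {δ γ : Ordinal.{u}}
  {c : Ordinal.{u} → Ordinal.{u}}

theorem IsLadder.exists_cover (hc : IsLadder P δ c) (hδ : Order.IsSuccLimit δ)
    {o : Ordinal.{u}} (ho : Order.IsSuccLimit o) (hcof : δ.cof ≠ o.cof)
    {t : Ordinal.{u} → Set Ordinal.{u}} (ht : ⋃ β : Iio (c δ), P β ⊆ t '' Iio o) :
    ∃ χ < o, ∀ i < δ, ∃ Q ∈ t '' Iio χ, c i ∈ Q ∧ Q ⊆ c '' Iio δ := by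
  have hidx : ∀ i < δ, ∃ ζ < o, t ζ = c '' Iic i := fun i hi ↦
    ht (mem_iUnion.2 ⟨⟨_, hc.normal.strictMono (hδ.succ_lt hi)⟩, hc.coherent i (hδ.succ_lt hi)⟩)
  choose! ζ hζ htζ using hidx
  obtain ⟨b, hb, hle⟩ := exists_forall_exists_le_of_cof_ne hcof hζ
  refine ⟨_, ho.succ_lt hb, fun i hi ↦ ?_⟩
  obtain ⟨j, hj, hij, hjb⟩ := hle i hi
  exact ⟨_, ⟨ζ j, Order.lt_succ_of_le hjb, htζ j hj⟩, mem_image_of_mem c hij,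
    image_mono (Iic_subset_Iio.2 hj)⟩

theorem exists_iUnion_subset_image_Iio (hmu : ℵ₀ ≤ mu)
    (hP : ∀ β < (Order.succ mu).ord, #(P β) < Cardinal.lift.{u + 1} (Order.succ mu))
    (hγ : γ < (Order.succ mu).ord) :
    ∃ t : Ordinal.{u} → Set Ordinal.{u}, ⋃ β : Iio γ, P β ⊆ t '' Iio mu.ord := by
  refine exists_subset_image_Iio (Order.lt_succ_iff.1 ?_)
  rw [← lift_succ]
  refine (card_iUnion_lt_iff_forall_of_isRegular (isRegular_succ hmu).lift ?_).2 fun β ↦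
    hP β (β.2.trans hγ)
  simpa only [Cardinal.lift_id] using mk_Iio_lt hγ

/-- `c` is a ladder for `P` with supremum `γ`, exhausted by those of the sets `t ζ` with `ζ < χ`
that it includes. -/
structure IsCoveredLadder (P : Ordinal.{u} → Set (Set Ordinal.{u}))
    (t : Ordinal.{u} → Set Ordinal.{u}) (δ χ γ : Ordinal.{u}) (c : Ordinal.{u} → Ordinal.{u}) :
    Prop extends IsLadder P δ c where
  map_eq : c δ = γ
  cover : ∀ i < δ, ∃ Q ∈ t '' Iio χ, c i ∈ Q ∧ Q ⊆ c '' Iio δ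

theorem IsCoveredLadder.mapsTo_of_eqOn {t : Ordinal.{u} → Set Ordinal.{u}} {χ : Ordinal.{u}}
    {E E' : Set Ordinal.{u}} (hc : IsCoveredLadder P t δ χ γ c) (hcE' : MapsTo c (Iio δ) E')
    (h : EqOn (· ⊆ E) (· ⊆ E') (t '' Iio χ)) : MapsTo c (Iio δ) E := fun i hi ↦ by
  obtain ⟨Q, hQ, hiQ, hQc⟩ := hc.cover i hi
  exact (h hQ).mpr (hQc.trans hcE'.image_subset) hiQ

theorem IsGuessSystem.exists_rigid_club (hP : IsGuessSystem (Order.succ mu) δ P) (hmu : ℵ₀ ≤ mu)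
    (hδ : Order.IsSuccLimit δ) (hcof : δ.cof ≠ mu.ord.cof)
    {t : Ordinal.{u} → Ordinal.{u} → Set Ordinal.{u}}
    (ht : ∀ γ < (Order.succ mu).ord, ⋃ β : Iio γ, P β ⊆ t γ '' Iio mu.ord) :
    ∃ E', ∀ E, IsClubIn E (Order.succ mu).ord → ∃ χ : Iio mu.ord, ∃ γ < (Order.succ mu).ord,
      (∃ c, IsCoveredLadder P (t γ) δ χ γ c ∧ MapsTo c (Iio δ) E') ∧
        ∀ c, IsCoveredLadder P (t γ) δ χ γ c → MapsTo c (Iio δ) E' → MapsTo c (Iio δ) E := by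
  have hmucof : mu < (Order.succ mu).ord.cof := lt_cof_ord_succ hmu
  have hexists : ∀ E, IsClubIn E (Order.succ mu).ord → ∃ s : Ordinal.{u} × Iio mu.ord,
      s.1 < (Order.succ mu).ord ∧
        ∃ c, IsCoveredLadder P (t s.1) δ s.2 s.1 c ∧ MapsTo c (Iio δ) E := fun E hE ↦ by
    obtain ⟨c, hc, hcδ, hcE⟩ := hP.exists_ladder E hE
    obtain ⟨χ, hχ, hcover⟩ := hc.exists_cover hδ (isSuccLimit_ord hmu) hcof (ht _ hcδ)
    exact ⟨(c δ, ⟨χ, hχ⟩), hcδ, c, ⟨hc, rfl, hcover⟩, hcE⟩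
  obtain ⟨E', hE', hstable⟩ := exists_stable_club hmu hmucof (r := fun E Q ↦ Q ⊆ E)
    (fun E F hEF Q hQ ↦ hQ.trans hEF) (A := fun s ↦ t s.1 '' Iio (s.2 : Ordinal))
    (fun s ↦ mk_image_Iio_lt s.2.2 _)
    (fun s E F hEF ⟨hs, c, hc, hcE⟩ ↦ ⟨hs, c, hc, hcE.mono_right hEF⟩) hexists
  refine ⟨E', fun E hE ↦ ?_⟩
  obtain ⟨⟨γ, χ⟩, ⟨hγ, c, hc, hcE⟩, heq⟩ :=
    hstable _ (hE.inter (hmu.trans_lt hmucof) hE') inter_subset_right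
  exact ⟨χ, γ, hγ, ⟨c, hc, hcE.mono_right inter_subset_right⟩, fun c' hc' hcE' ↦
    (hc'.mapsTo_of_eqOn hcE' heq).mono_right inter_subset_left⟩

theorem IsGuessSystem.exists_ladder_family (hP : IsGuessSystem (Order.succ mu) δ P)
    (hmu : ℵ₀ ≤ mu) (hδ : Order.IsSuccLimit δ) (hcof : δ.cof ≠ mu.ord.cof) :
    ∃ C : Ordinal.{u} → Ordinal.{u} → Ordinal.{u}, ∀ E, IsClubIn E (Order.succ mu).ord →
      ∃ γ < (Order.succ mu).ord, IsLadder P δ (C γ) ∧ C γ δ = γ ∧ MapsTo (C γ) (Iio δ) E := by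
  have hmucof : mu < (Order.succ mu).ord.cof := lt_cof_ord_succ hmu
  choose! t ht using fun γ ↦ exists_iUnion_subset_image_Iio (γ := γ) hmu hP.mk_lt
  obtain ⟨E', hrigid⟩ := hP.exists_rigid_club hmu hδ hcof ht
  obtain ⟨χ, hχ⟩ := exists_forall_isClubIn (hmu.trans_lt hmucof) (mk_Iio_lt (ord_lt_ord.2 hmucof))
    (fun χ E F hEF ⟨γ, hγ, hne, h⟩ ↦ ⟨γ, hγ, hne, fun c hc hcE ↦ (h c hc hcE).mono_right hEF⟩)
    hrigid
  choose! C hC hCE' using fun γ (h : ∃ c, IsCoveredLadder P (t γ) δ χ γ c ∧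
    MapsTo c (Iio δ) E') ↦ h
  refine ⟨C, fun E hE ↦ ?_⟩
  obtain ⟨γ, hγ, hne, h⟩ := hχ E hE
  exact ⟨γ, hγ, (hC γ hne).toIsLadder, (hC γ hne).map_eq, h _ (hC γ hne) (hCE' γ hne)⟩

end SingleLadder

section GreedyColor

variable {D : Ordinal.{u} → Set Ordinal.{u}} {β γ : Ordinal.{u}} {mu : Cardinal.{u}}

/-- The greedy colouring of the graph that joins each `γ` to the members of `D γ` below `γ`: the
colour of `γ` is the least ordinal that is not the colour of any of these members. -/
noncomputable def greedyColor (D : Ordinal.{u} → Set Ordinal.{u}) (γ : Ordinal.{u}) : Ordinal.{u} :=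
  sInf (range fun β : ↥(D γ ∩ Iio γ) ↦ greedyColor D β)ᶜ
termination_by γ
decreasing_by exact β.2.2

theorem greedyColor_lt (hD : #(D γ) < Cardinal.lift.{u + 1} mu) : greedyColor D γ < mu.ord := by
  rw [greedyColor, lt_ord, ← Cardinal.lift_lt.{u, u + 1}]
  exact (Ordinal.lift_card_sInf_compl_le _).trans_lt
    ((mk_range_le.trans (mk_le_mk_of_subset inter_subset_left)).trans_lt hD)

theorem greedyColor_ne [Small.{u} (D γ)] (hβ : β ∈ D γ) (hβγ : β < γ) :
    greedyColor D β ≠ greedyColor D γ := by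
  have : Small.{u} ↥(D γ ∩ Iio γ) := small_subset inter_subset_left
  have hmem := csInf_mem (nonempty_of_not_bddAbove (Ordinal.not_bddAbove_compl_of_small
    (range fun β : ↥(D γ ∩ Iio γ) ↦ greedyColor D β)))
  rw [← greedyColor] at hmem
  exact fun h ↦ hmem ⟨⟨β, hβ, hβγ⟩, h⟩

end GreedyColor

section LadderSystem

/-- A club-guessing ladder system on `S`: each `γ ∈ S` is the supremum of a ladder `C γ` of length
`δ` that avoids `S`. -/
structure IsLadderSystem (lam : Cardinal.{u}) (P : Ordinal.{u} → Set (Set Ordinal.{u}))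
    (δ : Ordinal.{u}) (C : Ordinal.{u} → Ordinal.{u} → Ordinal.{u}) (S : Set Ordinal.{u}) :
    Prop where
  lt_ord : ∀ γ ∈ S, γ < lam.ord
  isLadder : ∀ γ ∈ S, IsLadder P δ (C γ)
  map_eq : ∀ γ ∈ S, C γ δ = γ
  notMem : ∀ γ ∈ S, ∀ i < δ, C γ i ∉ S
  exists_mapsTo : ∀ E, IsClubIn E lam.ord → ∃ γ ∈ S, MapsTo (C γ) (Iio δ) E

variable {lam mu : Cardinal.{u}} {P : Ordinal.{u} → Set (Set Ordinal.{u})} {δ α γ : Ordinal.{u}}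
  {C : Ordinal.{u} → Ordinal.{u} → Ordinal.{u}} {S Q : Set Ordinal.{u}}

theorem IsGuessSystem.exists_isLadderSystem (hP : IsGuessSystem (Order.succ mu) δ P)
    (hδ : Order.IsSuccLimit δ) (hcard : δ.card < mu) (hcof : δ.cof ≠ mu.ord.cof) :
    ∃ C S, IsLadderSystem (Order.succ mu) P δ C S := by
  have hmu : ℵ₀ ≤ mu :=
    (Ordinal.aleph0_le_card.2 (Ordinal.omega0_le_of_isSuccLimit hδ)).trans hcard.le
  have hmucof : mu < (Order.succ mu).ord.cof := lt_cof_ord_succ hmu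
  obtain ⟨C, hC⟩ := hP.exists_ladder_family hmu hδ hcof
  let color := greedyColor fun γ ↦ C γ '' Iio δ
  have hcolor : ∀ γ, color γ < mu.ord := fun γ ↦
    greedyColor_lt (mk_image_Iio_lt (Cardinal.lt_ord.2 hcard) (C γ))
  obtain ⟨χ, hχ⟩ := exists_forall_isClubIn (hmu.trans_lt hmucof) (mk_Iio_lt (ord_lt_ord.2 hmucof))
    (Q := fun χ E ↦ ∃ γ < (Order.succ mu).ord, IsLadder P δ (C γ) ∧ C γ δ = γ ∧ color γ = χ ∧
      MapsTo (C γ) (Iio δ) E)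
    (fun χ E F hEF ⟨γ, hγ, hc, hcγ, hγχ, hcE⟩ ↦ ⟨γ, hγ, hc, hcγ, hγχ, hcE.mono_right hEF⟩)
    (fun E hE ↦ by
      obtain ⟨γ, hγ, hc, hcγ, hcE⟩ := hC E hE
      exact ⟨⟨_, hcolor γ⟩, γ, hγ, hc, hcγ, rfl, hcE⟩)
  refine ⟨C, {γ | γ < (Order.succ mu).ord ∧ IsLadder P δ (C γ) ∧ C γ δ = γ ∧ color γ = χ},
    fun γ hγ ↦ hγ.1, fun γ hγ ↦ hγ.2.1, fun γ hγ ↦ hγ.2.2.1, fun γ hγ i hi hiS ↦ ?_,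
    fun E hE ↦ ?_⟩
  · have hlt : C γ i < γ := (hγ.2.1.normal.strictMono hi).trans_eq hγ.2.2.1
    exact greedyColor_ne (D := fun γ ↦ C γ '' Iio δ) (mem_image_of_mem _ hi) hlt
      (hiS.2.2.2.trans hγ.2.2.2.symm)
  · obtain ⟨γ, hγ, hc, hcγ, hγχ, hcE⟩ := hχ E hE
    exact ⟨γ, ⟨hγ, hc, hcγ, hγχ⟩, hcE⟩

theorem IsLadderSystem.cof_eq (h : IsLadderSystem lam P δ C S) (hδ : Order.IsSuccLimit δ)
    (hγ : γ ∈ S) : γ.cof = δ.cof := by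
  rw [← Ordinal.cof_map_of_isNormal (h.isLadder γ hγ).normal hδ, h.map_eq γ hγ]

theorem IsLadderSystem.isStationaryIn (h : IsLadderSystem lam P δ C S)
    (hδ : Order.IsSuccLimit δ) : IsStationaryIn S lam.ord := by
  refine ⟨h.lt_ord, fun t ht ↦ ?_⟩
  have hE : IsClubIn (Subtype.val '' t) lam.ord :=
    ⟨by simp, by rwa [preimage_image_eq _ Subtype.val_injective]⟩
  obtain ⟨γ, hγ, hCE⟩ := h.exists_mapsTo _ hE
  have hmem : C γ δ ∈ Subtype.val '' t := hE.map_mem_of_mapsTo (h.isLadder γ hγ).normal hδ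
    ((h.map_eq γ hγ).trans_lt (h.lt_ord γ hγ)) hCE
  rw [h.map_eq γ hγ] at hmem
  obtain ⟨x, hx, rfl⟩ := hmem
  exact ⟨x, hγ, hx⟩

/-- The families `𝒫 α` of the theorem: all sets `C γ '' Iio i`, for `γ ∈ S`, with `C γ i = α`, such
that either `i = δ`, and then `α = γ`, or `C γ i` is a non-accumulation member of `C γ '' Iio δ`. -/
def segments (C : Ordinal.{u} → Ordinal.{u} → Ordinal.{u}) (S : Set Ordinal.{u})
    (δ α : Ordinal.{u}) : Set (Set Ordinal.{u}) :=
  {Q | ∃ γ ∈ S, ∃ i ≤ δ, (i = δ ∨ ¬ Order.IsSuccLimit i) ∧ C γ i = α ∧ Q = C γ '' Iio i}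

theorem IsLadderSystem.segments_eq_singleton (h : IsLadderSystem lam P δ C S) (hα : α ∈ S) :
    segments C S δ α = {C α '' Iio δ} := by
  ext Q
  rw [mem_singleton_iff]
  constructor
  · rintro ⟨γ, hγ, i, hi, -, rfl, rfl⟩
    obtain rfl : i = δ := hi.eq_of_not_lt fun hlt ↦ h.notMem γ hγ i hlt hα
    rw [h.map_eq γ hγ]
  · rintro rfl
    exact ⟨α, hα, δ, le_rfl, .inl rfl, h.map_eq α hα, rfl⟩

theorem IsLadderSystem.segments_subset (h : IsLadderSystem lam P δ C S) :
    segments C S δ α ⊆ insert (C α '' Iio δ) (insert ∅ (P α)) := by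
  rintro _ ⟨γ, hγ, i, hi, hiδ, rfl, rfl⟩
  obtain rfl | hlt := hi.eq_or_lt
  · exact .inl (by rw [h.map_eq γ hγ])
  obtain rfl | ⟨j, rfl⟩ | hlim := Ordinal.zero_or_succ_or_isSuccLimit i
  · exact .inr (.inl (by simp))
  · exact .inr (.inr (Order.Iio_succ j ▸ (h.isLadder γ hγ).coherent j hlt))
  · exact (hiδ.elim hlt.ne fun hnot ↦ hnot hlim).elim

theorem IsLadderSystem.mk_segments_lt (h : IsLadderSystem lam P δ C S) (hlam : ℵ₀ ≤ lam)
    (hP : #(P α) < Cardinal.lift.{u + 1} lam) :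
    #(segments C S δ α) < Cardinal.lift.{u + 1} lam := by
  have hlam' : ℵ₀ ≤ Cardinal.lift.{u + 1} lam := aleph0_le_lift.2 hlam
  have hone : 1 < Cardinal.lift.{u + 1} lam := one_lt_aleph0.trans_le hlam'
  refine (mk_le_mk_of_subset h.segments_subset).trans_lt (mk_insert_le.trans_lt ?_)
  exact add_lt_of_lt hlam' (mk_insert_le.trans_lt (add_lt_of_lt hlam' hP hone)) hone

theorem IsLadderSystem.inter_mem_segments (h : IsLadderSystem lam P δ C S)
    (hQ : Q ∈ segments C S δ α) {β : Ordinal.{u}} (hβ : β ∈ nacc Q) :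
    Q ∩ Iio β ∈ segments C S δ β := by
  obtain ⟨γ, hγ, i, hi, -, -, rfl⟩ := hQ
  have hnormal := (h.isLadder γ hγ).normal
  obtain ⟨j, hj, hjlim, rfl⟩ := exists_eq_of_mem_nacc_image_Iio hnormal hβ
  exact ⟨γ, hγ, j, hj.le.trans hi, .inr hjlim, rfl,
    image_Iio_inter_Iio hnormal.strictMono hj.le⟩

theorem IsLadderSystem.guessesClubs (h : IsLadderSystem lam P δ C S) (hδ : Order.IsSuccLimit δ)
    (hlam : ℵ₀ ≤ lam) (hP : ∀ β < lam.ord, #(P β) < Cardinal.lift.{u + 1} lam) :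
    GuessesClubs lam δ (segments C S δ) S where
  closed α hα := by
    refine ⟨?_, h.mk_segments_lt hlam (hP α hα)⟩
    rintro _ ⟨γ, hγ, i, -, -, rfl, rfl⟩
    exact isClosedIn_image_Iio (h.isLadder γ hγ).normal
  otp_lt α _ hα := by
    rintro _ ⟨γ, hγ, i, hi, -, rfl, rfl⟩
    rw [otp_image_Iio (h.isLadder γ hγ).normal.strictMono, Ordinal.lift_lt]
    exact hi.lt_of_ne fun hiδ ↦ hα (by rwa [hiδ, h.map_eq γ hγ])
  guess α hα := by
    have hnormal := (h.isLadder α hα).normal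
    refine ⟨_, h.segments_eq_singleton hα, otp_image_Iio hnormal.strictMono, ?_, ?_⟩
    · simpa only [h.map_eq α hα] using isClubIn_image_Iio hnormal hδ
    · exact disjoint_left.2 (forall_mem_image.2 (h.notMem α hα))
  coherent _ _ _ hQ _ hβ := h.inter_mem_segments hQ hβ
  guesses E hE := by
    obtain ⟨γ, hγ, hCE⟩ := h.exists_mapsTo E hE
    exact ⟨γ, hγ, _, (h.segments_eq_singleton hγ).ge rfl, hCE.image_subset⟩

end LadderSystem

end ClubGuessing

theorem claim1p12 (lam mu : Cardinal.{u}) (δ : Ordinal.{u})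
    (hlam : lam = Order.succ mu) (hδ : Order.IsSuccLimit δ)
    (hcard : δ.card < mu) (hcof : δ.cof ≠ mu.ord.cof) :
    ∃ (S : Set Ordinal.{u}) (P : Ordinal.{u} → Set (Set Ordinal.{u})),
      S ⊆ {α | α < lam.ord ∧ α.cof = δ.cof} ∧
      ClubGuessing.IsStationaryIn S lam.ord ∧
      ClubGuessing.GuessesClubs lam δ P S := by
  have hinf : ℵ₀ ≤ δ.card := Ordinal.aleph0_le_card.2 (Ordinal.omega0_le_of_isSuccLimit hδ)
  have hlam_inf : ℵ₀ ≤ lam := hlam ▸ (hinf.trans hcard.le).trans (Order.le_succ mu)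
  obtain ⟨P, hP⟩ := ClubGuessing.exists_isGuessSystem hinf hcard
  obtain ⟨C, S, hCS⟩ := hP.exists_isLadderSystem hδ hcard hcof
  rw [← hlam] at hP hCS
  exact ⟨S, ClubGuessing.segments C S δ, fun γ hγ ↦ ⟨hCS.lt_ord γ hγ, hCS.cof_eq hδ hγ⟩,
    hCS.isStationaryIn hδ, hCS.guessesClubs hδ hlam_inf hP.mk_lt⟩
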